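/- Let $n\ge 1$ be an integer and $\alpha\ge 0$ a real number. Let $\nu_{\alpha,n}$ be the probability measure on $\mathbb{R}$ with density $$f_{\alpha,n}(x)=\frac{c}{(1+\alpha^2+x^2)^{(n+1)/2}},\qquad x\in\mathbb{R},$$ where $c=c_{\alpha,n}>0$ is the normalizing constant (this is the normalized one-dimensional section of the $n$-dimensional isotropic Cauchy measure). For $-\infty\le a<b<\infty$ let $g_\alpha(a,b)\in\mathbb{R}$ be the unique real number with $$\nu_{\alpha,n}\big((-\infty,g_\alpha(a,b))\big)=\nu_{\alpha,n}\big((a,b)\big).$$ Then, for all $-\infty\le a<b<\infty$ (with the convention $-\infty-r=-\infty$): 1. for every $r>0$, $$g_\alpha(a-r,b+r)-g_\alpha(a,b)\ \ge\ \frac{r}{2^{1/n}};$$ 2. if $\nu_{\alpha,n}\big((a,b)\big)<\tfrac12$, then there is $r_0>0$ (which may depend on $a,b,\alpha,n$) such that for all $0<r<r_0$, $$g_\alpha(a-r,b+r)-g_\alpha(a,b)\ \ge\ r.$$ -/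

import Mathlib

open MeasureTheory Set Filter Topology

namespace CauchySection

/-- The unnormalised density `x ↦ 1 / (1 + α² + x²) ^ ((n + 1) / 2)`. -/
noncomputable def kernel (n : ℕ) (α x : ℝ) : ℝ :=
  1 / (1 + α ^ 2 + x ^ 2) ^ (((n : ℝ) + 1) / 2)

/-- The normalising constant, which makes the total mass equal to one. -/
noncomputable def normConst (n : ℕ) (α : ℝ) : ℝ :=
  (∫ x, kernel n α x)⁻¹

/-- The probability density `f_{α,n}` proportional to `1 / (1 + α² + x²) ^ ((n + 1) / 2)`. -/
noncomputable def density (n : ℕ) (α x : ℝ) : ℝ :=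
  normConst n α * kernel n α x

/-- The one-dimensional section `ν_{α,n}` of the `n`-dimensional isotropic Cauchy measure. -/
noncomputable def nu (n : ℕ) (α : ℝ) : Measure ℝ :=
  volume.withDensity fun x => ENNReal.ofReal (density n α x)

/-- The interval `(a, b)` of real numbers, where `a = -∞` is allowed. -/
def interval (a : EReal) (b : ℝ) : Set ℝ :=
  {x : ℝ | a < (x : EReal) ∧ x < b}

/-- `g_α(a, b)`: the real number `t` with `ν(-∞, t) = ν(a, b)`. For `1 ≤ n` and `a < b` it exists
and is unique, see `existsUnique_g`, `nu_Iio_g` and `eq_g`. -/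
noncomputable def g (n : ℕ) (α : ℝ) (a : EReal) (b : ℝ) : ℝ :=
  Classical.epsilon fun t : ℝ => nu n α (Iio t) = nu n α (interval a b)

theorem kernel_pos (n : ℕ) (α x : ℝ) : 0 < kernel n α x := by
  unfold kernel
  positivity

theorem continuous_kernel (n : ℕ) (α : ℝ) : Continuous (kernel n α) := by
  unfold kernel
  refine continuous_const.div ?_ fun x => by positivity
  refine Continuous.rpow_const (by fun_prop) fun x => Or.inr (by positivity)

theorem integrable_kernel {n : ℕ} (hn : 1 ≤ n) (α : ℝ) : Integrable (kernel n α) := by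
  have h1 : (Module.finrank ℝ ℝ : ℝ) < (n : ℝ) + 1 := by
    have : (1 : ℝ) ≤ n := by exact_mod_cast hn
    simp
    linarith
  refine (integrable_rpow_neg_one_add_norm_sq (μ := (volume : Measure ℝ)) h1).mono'
    (continuous_kernel n α).aestronglyMeasurable (Eventually.of_forall fun x => ?_)
  rw [Real.norm_of_nonneg (kernel_pos n α x).le, neg_div, Real.rpow_neg (by positivity),
    kernel, one_div, Real.norm_eq_abs, sq_abs]
  have h2 : (1 : ℝ) + x ^ 2 ≤ 1 + α ^ 2 + x ^ 2 := by nlinarith [sq_nonneg α]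
  gcongr

theorem normConst_pos {n : ℕ} (hn : 1 ≤ n) (α : ℝ) : 0 < normConst n α := by
  refine inv_pos.2 ?_
  rw [integral_pos_iff_support_of_nonneg (fun x => (kernel_pos n α x).le)
    (integrable_kernel hn α)]
  have : Function.support (kernel n α) = univ := by
    ext x
    simp [(kernel_pos n α x).ne']
  rw [this]
  simp

theorem density_pos {n : ℕ} (hn : 1 ≤ n) (α x : ℝ) : 0 < density n α x :=
  mul_pos (normConst_pos hn α) (kernel_pos n α x)

theorem integrable_density {n : ℕ} (hn : 1 ≤ n) (α : ℝ) : Integrable (density n α) :=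
  (integrable_kernel hn α).const_mul _

theorem integral_density {n : ℕ} (hn : 1 ≤ n) (α : ℝ) : ∫ x, density n α x = 1 := by
  have h := normConst_pos hn α
  unfold density
  rw [integral_const_mul]
  unfold normConst at h ⊢
  exact inv_mul_cancel₀ (inv_pos.1 h).ne'

theorem isProbabilityMeasure_nu {n : ℕ} (hn : 1 ≤ n) (α : ℝ) :
    IsProbabilityMeasure (nu n α) := by
  constructor
  rw [nu, withDensity_apply _ MeasurableSet.univ, setLIntegral_univ,
    ← ofReal_integral_eq_lintegral_ofReal (integrable_density hn α)
      (Eventually.of_forall fun x => (density_pos hn α x).le), integral_density hn α]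
  simp

theorem volume_absolutelyContinuous_nu {n : ℕ} (hn : 1 ≤ n) (α : ℝ) :
    (volume : Measure ℝ) ≪ nu n α := by
  refine withDensity_absolutelyContinuous' ?_ (Eventually.of_forall fun x => ?_)
  · exact (integrable_density hn α).aestronglyMeasurable.aemeasurable.ennreal_ofReal
  · simpa using density_pos hn α x

theorem nu_Iio_strictMono {n : ℕ} (hn : 1 ≤ n) (α : ℝ) :
    StrictMono fun t : ℝ => nu n α (Iio t) := by
  intro s t hst
  have := isProbabilityMeasure_nu hn α
  have := (volume_absolutelyContinuous_nu hn α).isOpenPosMeasure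
  have hpos : 0 < nu n α (Ioo s t) := isOpen_Ioo.measure_pos _ (nonempty_Ioo.2 hst)
  have hd : Disjoint (Iio s) (Ioo s t) :=
    disjoint_left.2 fun x hx hx' => lt_asymm hx hx'.1
  calc nu n α (Iio s) < nu n α (Iio s) + nu n α (Ioo s t) :=
        ENNReal.lt_add_right (measure_ne_top _ _) hpos.ne'
    _ = nu n α (Iio s ∪ Ioo s t) := (measure_union hd measurableSet_Ioo).symm
    _ ≤ nu n α (Iio t) := measure_mono (union_subset (Iio_subset_Iio hst.le) fun x hx => hx.2)

theorem nu_Iio_eq {n : ℕ} (hn : 1 ≤ n) (α t : ℝ) :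
    nu n α (Iio t) = ENNReal.ofReal (∫ x in Iic t, density n α x) := by
  rw [nu, withDensity_apply _ measurableSet_Iio,
    ← ofReal_integral_eq_lintegral_ofReal (integrable_density hn α).integrableOn
      (Eventually.of_forall fun x => (density_pos hn α x).le), integral_Iic_eq_integral_Iio]

theorem continuous_nu_Iio {n : ℕ} (hn : 1 ≤ n) (α : ℝ) :
    Continuous fun t : ℝ => nu n α (Iio t) := by
  have h : ∀ t : ℝ, ∫ x in Iic t, density n α x
      = (∫ x in (0 : ℝ)..t, density n α x) + ∫ x in Iic 0, density n α x := fun t => by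
    rw [← intervalIntegral.integral_Iic_sub_Iic (integrable_density hn α).integrableOn
      (integrable_density hn α).integrableOn]
    ring
  rw [show (fun t : ℝ => nu n α (Iio t)) = fun t => ENNReal.ofReal
      ((∫ x in (0 : ℝ)..t, density n α x) + ∫ x in Iic 0, density n α x) from
    funext fun t => by rw [nu_Iio_eq hn α t, h t]]
  exact ENNReal.continuous_ofReal.comp
    (((integrable_density hn α).continuous_primitive 0).add continuous_const)

theorem measurableSet_interval (a : EReal) (b : ℝ) : MeasurableSet (interval a b) :=
  (measurableSet_lt measurable_const measurable_coe_real_ereal).inter measurableSet_Iio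

theorem existsUnique_g {n : ℕ} (hn : 1 ≤ n) (α : ℝ) {a : EReal} {b : ℝ} (hab : a < b) :
    ∃! t : ℝ, nu n α (Iio t) = nu n α (interval a b) := by
  have := isProbabilityMeasure_nu hn α
  have := (volume_absolutelyContinuous_nu hn α).isOpenPosMeasure
  refine existsUnique_of_exists_of_unique ?_ fun s t hs ht =>
    (nu_Iio_strictMono hn α).injective (hs.trans ht.symm)
  have hle : nu n α (interval a b) ≤ nu n α (Iio b) := measure_mono fun x hx => hx.2
  have hpos : 0 < nu n α (interval a b) := by
    have ho : IsOpen (interval a b) :=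
      (isOpen_lt continuous_const continuous_coe_real_ereal).inter isOpen_Iio
    refine ho.measure_pos _ ?_
    obtain ⟨c, hac, hcb⟩ := EReal.lt_iff_exists_real_btwn.1 hab
    exact ⟨c, hac, by exact_mod_cast hcb⟩
  have hbot : Tendsto (fun t : ℝ => nu n α (Iio t)) atBot (𝓝 0) := by
    have h := ENNReal.tendsto_ofReal (ProbabilityTheory.tendsto_cdf_atBot (nu n α))
    simp only [ProbabilityTheory.ofReal_cdf, ENNReal.ofReal_zero] at h
    exact tendsto_of_tendsto_of_tendsto_of_le_of_le tendsto_const_nhds h (fun _ => zero_le)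
      fun t => measure_mono Iio_subset_Iic_self
  obtain ⟨s, hs⟩ := (hbot.eventually (gt_mem_nhds hpos)).exists
  exact mem_range_of_exists_le_of_exists_ge (continuous_nu_Iio hn α) ⟨s, hs.le⟩ ⟨b, hle⟩

theorem nu_Iio_g {n : ℕ} (hn : 1 ≤ n) (α : ℝ) {a : EReal} {b : ℝ} (hab : a < b) :
    nu n α (Iio (g n α a b)) = nu n α (interval a b) :=
  Classical.epsilon_spec (existsUnique_g hn α hab).exists

theorem eq_g {n : ℕ} (hn : 1 ≤ n) (α : ℝ) {a : EReal} {b : ℝ} (hab : a < b) {t : ℝ}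
    (ht : nu n α (Iio t) = nu n α (interval a b)) : t = g n α a b :=
  (existsUnique_g hn α hab).unique ht (nu_Iio_g hn α hab)

end CauchySection

namespace CauchySection

/-! Write `S = 1 + α²`, `k = kernel`, `F = tailMass`. If `F w = F (b + t) - F (a - t)`, then `w = g
(a - t) (b + t)` moves at speed `(k (b + t) + k (a - t)) / k w`, so both claims reduce to lower
bounds on this ratio, integrated by `tailMass_add_mul_le`. Let `x = a - t`, `y = -(b + t)`; by
symmetry `F x + F y = F (-w)`.

Claim 1: `k = J ^ (1 + 1/n)` with `J = (S + x²) ^ (-n/2)`, and `J` is a concave function of `F`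
vanishing at mass 0, hence subadditive; the power mean inequality costs the factor `2 ^ (1/n)`
(`kernel_le_two_rpow_mul`).

Claim 2: mass below one half means `w < 0`, and this persists for small `t`. The tails at `x`, `y`,
`w` share the full mass, and `kernel_le_add_of_tailMass_add_eq` gives speed at least 1. Its core is
`kernel_zero_le_add`, where the inversion `t ↦ S / t`, which preserves `k' / k`, pairs far points
with near ones. -/

/-- The unnormalised distribution function `t ↦ ∫_{-∞}^t kernel`. -/
noncomputable def tailMass (n : ℕ) (α t : ℝ) : ℝ :=
  ∫ x in Iic t, kernel n α x

/-! ### Monotonicity from the sign of a derivative -/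

section calculus

theorem monotoneOn_Iic_of_hasDerivAt_nonneg {f f' : ℝ → ℝ} {y : ℝ}
    (hf : ∀ x ≤ y, HasDerivAt f (f' x) x) (h : ∀ x < y, 0 ≤ f' x) : MonotoneOn f (Iic y) := by
  refine monotoneOn_of_deriv_nonneg (convex_Iic y)
    (fun x hx => (hf x hx).continuousAt.continuousWithinAt) (fun x hx => ?_) fun x hx => ?_
  · rw [interior_Iic] at hx
    exact (hf x (le_of_lt hx)).differentiableAt.differentiableWithinAt
  · rw [interior_Iic] at hx
    rw [(hf x (le_of_lt hx)).deriv]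
    exact h x hx

theorem le_of_hasDerivAt_nonneg_of_tendsto_atBot {f f' : ℝ → ℝ} {y l : ℝ}
    (hf : ∀ x ≤ y, HasDerivAt f (f' x) x) (h : ∀ x < y, 0 ≤ f' x)
    (hl : Tendsto f atBot (𝓝 l)) : l ≤ f y :=
  le_of_tendsto hl <| (eventually_le_atBot y).mono fun _ hx =>
    monotoneOn_Iic_of_hasDerivAt_nonneg hf h hx (mem_Iic.2 le_rfl) hx

theorem le_of_hasDerivAt_nonneg {f f' : ℝ → ℝ} {x y : ℝ} (hxy : x ≤ y)
    (hf : ∀ t ∈ Icc x y, HasDerivAt f (f' t) t) (h : ∀ t ∈ Ioo x y, 0 ≤ f' t) : f x ≤ f y := by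
  refine monotoneOn_of_deriv_nonneg (convex_Icc x y)
    (fun t ht => (hf t ht).continuousAt.continuousWithinAt) (fun t ht => ?_) (fun t ht => ?_)
    (left_mem_Icc.2 hxy) (right_mem_Icc.2 hxy) hxy
  · rw [interior_Icc] at ht
    exact (hf t (Ioo_subset_Icc_self ht)).differentiableAt.differentiableWithinAt
  · rw [interior_Icc] at ht
    rw [(hf t (Ioo_subset_Icc_self ht)).deriv]
    exact h t ht

end calculus

/-! ### Symmetry, derivative and decay of the density -/

section kernel

theorem kernel_neg (n : ℕ) (α x : ℝ) : kernel n α (-x) = kernel n α x := by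
  simp [kernel]

theorem kernel_eq_rpow_neg (n : ℕ) (α x : ℝ) :
    kernel n α x = (1 + α ^ 2 + x ^ 2) ^ (-(((n : ℝ) + 1) / 2)) := by
  rw [kernel, Real.rpow_neg (by positivity), one_div]

theorem kernel_le_kernel_of_sq_le {n : ℕ} {α x y : ℝ} (h : x ^ 2 ≤ y ^ 2) :
    kernel n α y ≤ kernel n α x := by
  unfold kernel
  gcongr

theorem hasDerivAt_rpow_neg_add_sq {S : ℝ} (hS : 0 < S) (m x : ℝ) :
    HasDerivAt (fun x : ℝ => (S + x ^ 2) ^ (-m))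
      (-(2 * m * x / (S + x ^ 2)) * (S + x ^ 2) ^ (-m)) x := by
  have hp : 0 < S + x ^ 2 := by positivity
  have h1 : HasDerivAt (fun x : ℝ => S + x ^ 2) (2 * x) x := by
    simpa using (hasDerivAt_pow 2 x).const_add S
  convert h1.rpow_const (p := -m) (Or.inl hp.ne') using 1
  rw [Real.rpow_sub_one hp.ne']
  field_simp

theorem hasDerivAt_kernel (n : ℕ) (α x : ℝ) :
    HasDerivAt (kernel n α) (-(((n : ℝ) + 1) * x / (1 + α ^ 2 + x ^ 2)) * kernel n α x) x := by
  have h := hasDerivAt_rpow_neg_add_sq (S := 1 + α ^ 2) (by positivity) (((n : ℝ) + 1) / 2) x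
  rw [← kernel_eq_rpow_neg, show (2 : ℝ) * (((n : ℝ) + 1) / 2) = n + 1 by ring] at h
  exact h.congr_of_eventuallyEq (Eventually.of_forall fun y => kernel_eq_rpow_neg n α y)

theorem tendsto_rpow_neg_add_sq_atBot (S : ℝ) {m : ℝ} (hm : 0 < m) :
    Tendsto (fun x : ℝ => (S + x ^ 2) ^ (-m)) atBot (𝓝 0) :=
  (tendsto_rpow_neg_atTop hm).comp <|
    tendsto_atTop_add_const_left _ S ((tendsto_pow_atTop two_ne_zero).comp tendsto_abs_atBot_atTop |>.congr fun x => sq_abs x)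

theorem tendsto_kernel_atBot (n : ℕ) (α : ℝ) : Tendsto (kernel n α) atBot (𝓝 0) := by
  rw [show kernel n α = _ from funext (kernel_eq_rpow_neg n α)]
  exact tendsto_rpow_neg_add_sq_atBot _ (by positivity)

end kernel

/-! ### The distribution function -/

section tailMass

variable {n : ℕ}

theorem tailMass_eq_add (hn : 1 ≤ n) (α s t : ℝ) :
    tailMass n α t = tailMass n α s + ∫ x in s..t, kernel n α x := by
  rw [← intervalIntegral.integral_Iic_sub_Iic (integrable_kernel hn α).integrableOn
      (integrable_kernel hn α).integrableOn, tailMass, tailMass]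
  ring

theorem hasDerivAt_tailMass (hn : 1 ≤ n) (α t : ℝ) :
    HasDerivAt (tailMass n α) (kernel n α t) t := by
  rw [show tailMass n α = _ from funext (tailMass_eq_add hn α 0)]
  exact ((continuous_kernel n α).integral_hasStrictDerivAt 0 t).hasDerivAt.const_add _

theorem continuous_tailMass (hn : 1 ≤ n) (α : ℝ) : Continuous (tailMass n α) :=
  continuous_iff_continuousAt.2 fun t => (hasDerivAt_tailMass hn α t).continuousAt

theorem strictMono_tailMass (hn : 1 ≤ n) (α : ℝ) : StrictMono (tailMass n α) :=
  strictMono_of_deriv_pos fun t => by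
    rw [(hasDerivAt_tailMass hn α t).deriv]
    exact kernel_pos n α t

theorem tendsto_tailMass_atBot (hn : 1 ≤ n) (α : ℝ) :
    Tendsto (tailMass n α) atBot (𝓝 0) := by
  have h := intervalIntegral_tendsto_integral_Iic 0 (integrable_kernel hn α).integrableOn tendsto_id
  have h2 := h.const_sub (tailMass n α 0)
  rw [tailMass, sub_self] at h2
  refine h2.congr fun t => ?_
  have := tailMass_eq_add hn α t 0
  rw [tailMass] at this
  simp only [id]
  linarith

theorem tailMass_nonneg (n : ℕ) (α t : ℝ) : 0 ≤ tailMass n α t :=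
  integral_nonneg fun x => (kernel_pos n α x).le

theorem tailMass_neg (hn : 1 ≤ n) (α t : ℝ) :
    tailMass n α (-t) = 2 * tailMass n α 0 - tailMass n α t := by
  have h0 := tailMass_eq_add hn α 0 (-t)
  have h1 := tailMass_eq_add hn α 0 t
  have h2 : ∫ x in (0 : ℝ)..(-t), kernel n α x = -∫ x in (0 : ℝ)..t, kernel n α x := by
    have := intervalIntegral.integral_comp_neg (a := 0) (b := t) (kernel n α)
    simp only [kernel_neg, neg_zero] at this
    rw [intervalIntegral.integral_symm, this]
  linarith

theorem integral_kernel_eq (hn : 1 ≤ n) (α : ℝ) :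
    ∫ x, kernel n α x = 2 * tailMass n α 0 := by
  have h := integral_comp_neg_Iic 0 (kernel n α)
  simp only [kernel_neg, neg_zero] at h
  rw [← intervalIntegral.integral_Iic_add_Ioi (b := 0) (integrable_kernel hn α).integrableOn
    (integrable_kernel hn α).integrableOn, ← h, tailMass]
  ring

end tailMass

/-! ### Two tails: subadditivity up to `2 ^ (1/n)` -/

section subadditivity

theorem monotone_div_sqrt_add_sq {S : ℝ} (hS : 0 < S) :
    Monotone fun x : ℝ => x / √(S + x ^ 2) := by
  have key : ∀ x y : ℝ, 0 ≤ x → x ≤ y → x * √(S + y ^ 2) ≤ y * √(S + x ^ 2) := by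
    intro x y hx hxy
    refine (pow_le_pow_iff_left₀ (by positivity)
      (mul_nonneg (hx.trans hxy) (Real.sqrt_nonneg _)) two_ne_zero).1 ?_
    rw [mul_pow, mul_pow, Real.sq_sqrt (by positivity), Real.sq_sqrt (by positivity)]
    nlinarith [pow_le_pow_left₀ hx hxy 2]
  intro x y hxy
  have hpos : ∀ x : ℝ, 0 < √(S + x ^ 2) := fun x => Real.sqrt_pos.2 (by positivity)
  change x / √(S + x ^ 2) ≤ y / √(S + y ^ 2)
  rw [div_le_div_iff₀ (hpos x) (hpos y)]
  rcases le_total 0 x with hx | hx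
  · exact key x y hx hxy
  rcases le_total 0 y with hy | hy
  · exact (mul_nonpos_of_nonpos_of_nonneg hx (hpos y).le).trans (mul_nonneg hy (hpos x).le)
  · have := key (-y) (-x) (by linarith) (by linarith)
    simp only [neg_sq] at this
    linarith

theorem hasDerivAt_rpow_neg_half (n : ℕ) (α x : ℝ) :
    HasDerivAt (fun x : ℝ => (1 + α ^ 2 + x ^ 2) ^ (-((n : ℝ) / 2)))
      (-(n * (x / √(1 + α ^ 2 + x ^ 2))) * kernel n α x) x := by
  have hp : 0 < 1 + α ^ 2 + x ^ 2 := by positivity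
  convert hasDerivAt_rpow_neg_add_sq (S := 1 + α ^ 2) (by positivity) ((n : ℝ) / 2) x using 1
  have h : (1 + α ^ 2 + x ^ 2) ^ (-((n : ℝ) / 2))
      = kernel n α x * √(1 + α ^ 2 + x ^ 2) := by
    rw [kernel_eq_rpow_neg, Real.sqrt_eq_rpow, ← Real.rpow_add hp]
    ring_nf
  have hs := Real.sq_sqrt hp.le
  have hs0 := (Real.sqrt_pos.2 hp).ne'
  rw [h]
  generalize √(1 + α ^ 2 + x ^ 2) = s at *
  rw [← hs]
  field_simp

variable {n : ℕ}

/-- Concavity in the mass: by `hasDerivAt_rpow_neg_half`, `dJ/dF = -n t / √(S + t²)`, which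
decreases in `t`. Comparing with the slope at `y` gives `J z - J y ≤ ψ y * F x ≤ J x`. -/
theorem rpow_neg_half_le_add (hn : 1 ≤ n) (α : ℝ) {x y z : ℝ}
    (h : tailMass n α x + tailMass n α y = tailMass n α z) :
    (1 + α ^ 2 + z ^ 2) ^ (-((n : ℝ) / 2))
      ≤ (1 + α ^ 2 + x ^ 2) ^ (-((n : ℝ) / 2)) + (1 + α ^ 2 + y ^ 2) ^ (-((n : ℝ) / 2)) := by
  wlog hxy : x ≤ y generalizing x y
  · rw [add_comm ((1 + α ^ 2 + x ^ 2) ^ (-((n : ℝ) / 2)))]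
    exact this (by linarith) (le_of_not_ge hxy)
  have hn0 : (0 : ℝ) < n := by exact_mod_cast hn
  have hyz : y ≤ z := (strictMono_tailMass hn α).le_iff_le.1 <| by
    linarith [tailMass_nonneg n α x]
  set ψ : ℝ → ℝ := fun t => -(n * (t / √(1 + α ^ 2 + t ^ 2))) with hψ
  have hanti : Antitone ψ := fun s t hst => by
    have := monotone_div_sqrt_add_sq (S := 1 + α ^ 2) (by positivity) hst
    simp only [hψ]
    gcongr
  have hd : ∀ t, HasDerivAt (fun t => (1 + α ^ 2 + t ^ 2) ^ (-((n : ℝ) / 2))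
      - ψ y * tailMass n α t) ((ψ t - ψ y) * kernel n α t) t := fun t => by
    rw [sub_mul]
    exact (hasDerivAt_rpow_neg_half n α t).sub ((hasDerivAt_tailMass hn α t).const_mul _)
  have h1 := le_of_hasDerivAt_nonneg_of_tendsto_atBot (y := x) (fun t _ => hd t)
    (fun t ht => mul_nonneg (sub_nonneg.2 (hanti (ht.le.trans hxy))) (kernel_pos n α t).le)
    ((tendsto_rpow_neg_add_sq_atBot (1 + α ^ 2) (m := (n : ℝ) / 2) (by positivity)).sub
      ((tendsto_tailMass_atBot hn α).const_mul (ψ y)))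
  have h2 := le_of_hasDerivAt_nonneg hyz (fun t _ => (hd t).neg) fun t ht =>
    neg_nonneg.2 (mul_nonpos_of_nonpos_of_nonneg (sub_nonpos.2 (hanti ht.1.le))
      (kernel_pos n α t).le)
  simp only [Pi.neg_apply] at h2
  rw [← h] at h2
  linarith

/-- The isoperimetric profile is subadditive up to the factor `2 ^ (1 / n)`. -/
theorem kernel_le_two_rpow_mul (hn : 1 ≤ n) (α : ℝ) {x y z : ℝ}
    (h : tailMass n α x + tailMass n α y = tailMass n α z) :
    kernel n α z ≤ (2 : ℝ) ^ (1 / (n : ℝ)) * (kernel n α x + kernel n α y) := by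
  have hn0 : (0 : ℝ) < n := by exact_mod_cast hn
  have hk : ∀ t, kernel n α t
      = ((1 + α ^ 2 + t ^ 2) ^ (-((n : ℝ) / 2))) ^ (1 + 1 / (n : ℝ)) := fun t => by
    rw [kernel_eq_rpow_neg, ← Real.rpow_mul (by positivity)]
    congr 1
    field_simp
  have hJ : ∀ t : ℝ, 0 ≤ (1 + α ^ 2 + t ^ 2) ^ (-((n : ℝ) / 2)) := fun t => by positivity
  have hp : 1 ≤ 1 + 1 / (n : ℝ) := by simp
  have hm := NNReal.rpow_add_le_mul_rpow_add_rpow ⟨_, hJ x⟩ ⟨_, hJ y⟩ hp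
  have hm' := NNReal.coe_le_coe.2 hm
  push_cast at hm'
  simp only [add_sub_cancel_left] at hm'
  rw [hk x, hk y, hk z]
  exact (Real.rpow_le_rpow (hJ z) (rpow_neg_half_le_add hn α h) (by positivity)).trans hm'

end subadditivity

/-! ### Three tails: the inversion `t ↦ S / t` -/

section threeTails

variable {n : ℕ}

theorem hasDerivAt_const_div {S t : ℝ} (ht : t ≠ 0) :
    HasDerivAt (fun t => S / t) (-(S / t ^ 2)) t := by
  simpa [div_eq_mul_inv] using (hasDerivAt_inv ht).const_mul S

/-- The ratio of the right side to the left is `(S / t²) ^ ((1 - n) / 2)`, at least 1 since `n ≥ 1`.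
-/
theorem kernel_le_kernel_div_mul (hn : 1 ≤ n) {α t : ℝ} (ht : t < 0) (h : 1 + α ^ 2 ≤ t ^ 2) :
    kernel n α t ≤ kernel n α ((1 + α ^ 2) / t) * ((1 + α ^ 2) / t ^ 2) := by
  set S := 1 + α ^ 2 with hS
  have hS0 : 0 < S := by positivity
  have ht0 := ht.ne
  have ht2 : 0 < t ^ 2 := by positivity
  have hn1 : (1 : ℝ) ≤ n := by exact_mod_cast hn
  have e : S + (S / t) ^ 2 = (S / t ^ 2) * (S + t ^ 2) := by
    field_simp
    ring
  have h1 : S / t ^ 2 ≤ 1 := (div_le_one ht2).2 h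
  rw [kernel_eq_rpow_neg, kernel_eq_rpow_neg, ← hS, e,
    Real.mul_rpow (by positivity) (by positivity), mul_right_comm]
  refine le_mul_of_one_le_left (by positivity) ?_
  rw [← Real.rpow_add_one (by positivity)]
  exact Real.one_le_rpow_of_pos_of_le_one_of_nonpos (by positivity) h1 (by linarith)

theorem tendsto_const_div_atBot (S : ℝ) : Tendsto (fun t : ℝ => S / t) atBot (𝓝 0) :=
  tendsto_const_nhds.div_atBot tendsto_id

/-- The left side is nonincreasing in `t` by `kernel_le_kernel_div_mul` and tends to `F 0` at `-∞`.
-/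
theorem tailMass_add_tailMass_div_le (hn : 1 ≤ n) {α t : ℝ} (ht : t < 0)
    (h : 1 + α ^ 2 ≤ t ^ 2) :
    tailMass n α t + tailMass n α ((1 + α ^ 2) / t) ≤ tailMass n α 0 := by
  have hlim : Tendsto (fun t => -(tailMass n α t + tailMass n α ((1 + α ^ 2) / t))) atBot
      (𝓝 (-(0 + tailMass n α 0))) :=
    ((tendsto_tailMass_atBot hn α).add
      (((continuous_tailMass hn α).tendsto 0).comp (tendsto_const_div_atBot _))).neg
  have := le_of_hasDerivAt_nonneg_of_tendsto_atBot (y := t) (fun s hs =>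
    ((hasDerivAt_tailMass hn α s).add ((hasDerivAt_tailMass hn α _).comp s
      (hasDerivAt_const_div (hs.trans_lt ht).ne))).neg) (fun s hs => by
        have := kernel_le_kernel_div_mul hn (α := α) (hs.trans ht) (by nlinarith)
        linarith) hlim
  simp only [Pi.neg_apply, Pi.add_apply, Function.comp_apply] at this
  linarith

/-- With `φ = k' / k = dk/dF` and `q = k - φ y * F`, it suffices that `q 0 ≤ q x + q y`, because `φ
y ≥ 0`. -/
theorem kernel_zero_le_add (hn : 1 ≤ n) (α : ℝ) {x y : ℝ} (hxy : x ≤ y) (hy : y < 0)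
    (h : tailMass n α 0 ≤ tailMass n α x + tailMass n α y) :
    kernel n α 0 ≤ kernel n α x + kernel n α y := by
  set S := 1 + α ^ 2 with hS
  have hS0 : 0 < S := by positivity
  have hx : x < 0 := hxy.trans_lt hy
  -- Otherwise `y < S / x`, and `F x + F y` would fall below `F 0`.
  have hxyS : x * y ≤ S := by
    by_contra! hc
    have h1 := tailMass_add_tailMass_div_le hn (α := α) hx (by nlinarith)
    have h2 : y < S / x := by
      rw [lt_div_iff_of_neg hx]
      linarith
    linarith [strictMono_tailMass hn α h2]
  have hyS : y ^ 2 ≤ S := by nlinarith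
  set y' := S / y with hy'
  have hy'0 : y' < 0 := div_neg_of_pos_of_neg hS0 hy
  have hyy : y' * y = S := div_mul_cancel₀ _ hy.ne
  have hyx : y' ≤ x := by
    rw [hy', div_le_iff_of_neg hy]
    exact hxyS
  have hSy' : S ≤ y' ^ 2 := by
    have : y' ≤ y := hyx.trans hxy
    nlinarith
  set φ : ℝ → ℝ := fun t => -(((n : ℝ) + 1) * t / (S + t ^ 2)) with hφ
  have hφsub : ∀ t, φ t - φ y
      = (n + 1) / ((S + t ^ 2) * (S + y ^ 2)) * ((t - y) * (t * y - S)) := fun t => by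
    have : S + t ^ 2 ≠ 0 := by positivity
    have : S + y ^ 2 ≠ 0 := by positivity
    simp only [hφ]
    field_simp
    ring
  have hφ_le : ∀ t ≤ y', φ t ≤ φ y := fun t ht => by
    rw [← sub_nonpos, hφsub]
    refine mul_nonpos_of_nonneg_of_nonpos (by positivity) (mul_nonpos_of_nonpos_of_nonneg ?_ ?_)
    · linarith
    · nlinarith
  have hφ_ge : ∀ t, y' ≤ t → t ≤ y → φ y ≤ φ t := fun t ht hty => by
    rw [← sub_nonneg, hφsub]
    refine mul_nonneg (by positivity) (mul_nonneg_of_nonpos_of_nonpos ?_ ?_)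
    · linarith
    · nlinarith
  have hφ_div : ∀ t, t < 0 → φ (S / t) = φ t := fun t ht => by
    have := ht.ne
    have h1 : S + t ^ 2 ≠ 0 := by positivity
    have h2 : S + (S / t) ^ 2 = (S / t ^ 2) * (S + t ^ 2) := by
      field_simp
      ring
    simp only [hφ]
    rw [h2]
    field_simp
  set q : ℝ → ℝ := fun t => kernel n α t - φ y * tailMass n α t with hq
  have hqd : ∀ t, HasDerivAt q ((φ t - φ y) * kernel n α t) t := fun t => by
    rw [sub_mul]
    exact (hasDerivAt_kernel n α t).sub ((hasDerivAt_tailMass hn α t).const_mul _)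
  have hlim0 : Tendsto q atBot (𝓝 (0 - φ y * 0)) :=
    (tendsto_kernel_atBot n α).sub ((tendsto_tailMass_atBot hn α).const_mul _)
  have hqc : Tendsto q (𝓝 0) (𝓝 (q 0)) := (hqd 0).continuousAt
  -- `q t + q (S / t)` has derivative `(φ t - φ y) * (k t - k (S / t) * S / t²)`, a product of two
  -- nonpositive factors; from `-∞` to `y'` this gives `q 0 ≤ q y' + q y`.
  have h1 := le_of_hasDerivAt_nonneg_of_tendsto_atBot (y := y') (fun t ht =>
    (hqd t).add ((hqd _).comp t (hasDerivAt_const_div (S := S) (ht.trans_lt hy'0).ne)))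
    (fun t ht => by
      have ht0 := ht.trans hy'0
      have hk := kernel_le_kernel_div_mul hn (α := α) ht0 (by nlinarith)
      rw [hφ_div t ht0]
      nlinarith [hφ_le t ht.le])
    (hlim0.add (hqc.comp (tendsto_const_div_atBot S)))
  have h2 := le_of_hasDerivAt_nonneg hyx (fun t _ => hqd t) fun t ht =>
    mul_nonneg (sub_nonneg.2 (hφ_ge t ht.1.le (ht.2.le.trans hxy))) (kernel_pos n α t).le
  have hyy' : S / y' = y := by
    rw [hy']
    field_simp
  simp only [Pi.add_apply, Function.comp_apply, hyy'] at h1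
  simp only [hq] at h1 h2
  have hφ0 : 0 ≤ φ y := by
    simp only [hφ]
    rw [← neg_div]
    refine div_nonneg ?_ (by positivity)
    nlinarith [(Nat.cast_nonneg n : (0 : ℝ) ≤ n)]
  nlinarith

/-- Of three tails which together have the full mass, one that has at most half of it has at most
the boundary density of the other two. -/
theorem kernel_le_add_of_tailMass_add_eq (hn : 1 ≤ n) (α : ℝ) {x y z : ℝ} (hz : z ≤ 0)
    (h : tailMass n α x + tailMass n α y + tailMass n α z = 2 * tailMass n α 0) :
    kernel n α z ≤ kernel n α x + kernel n α y := by
  wlog hxy : x ≤ y generalizing x y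
  · rw [add_comm]
    exact this (by linarith) (le_of_not_ge hxy)
  have hz0 : tailMass n α z ≤ tailMass n α 0 := (strictMono_tailMass hn α).monotone hz
  -- If `y ≥ 0`, its complementary tail contains that of `z`, so `k y` alone suffices; otherwise `k
  -- z ≤ k 0`.
  rcases le_or_gt 0 y with hy | hy
  · have h1 : z ≤ -y := (strictMono_tailMass hn α).le_iff_le.1 <| by
      rw [tailMass_neg hn]
      linarith [tailMass_nonneg n α x]
    have : kernel n α z ≤ kernel n α y := kernel_le_kernel_of_sq_le (by nlinarith)
    linarith [kernel_pos n α x]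
  · have := kernel_zero_le_add hn α hxy hy (by linarith)
    exact (kernel_le_kernel_of_sq_le (by nlinarith)).trans this

end threeTails

/-! ### Integrating the speed bound -/

section growth

variable {n : ℕ}

/-- Comparison principle for the solution `z` of `tailMass z = tailMass (b + t) - tailMass (a - t)`:
a lower bound on its speed integrates. -/
theorem tailMass_add_mul_le (hn : 1 ≤ n) {α a b z L T : ℝ} (hT : 0 < T)
    (hz : tailMass n α z = tailMass n α b - tailMass n α a)
    (h : ∀ t, 0 ≤ t → t < T → ∀ w, tailMass n α w = tailMass n α (b + t) - tailMass n α (a - t) →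
      L * kernel n α w ≤ kernel n α (b + t) + kernel n α (a - t)) :
    tailMass n α (z + L * T) ≤ tailMass n α (b + T) - tailMass n α (a - T) := by
  -- A strictly smaller speed `l` makes the derivative inequality strict at any contact point; then
  -- `l` tends to `L`.
  have key : ∀ l < L, tailMass n α (z + l * T) ≤ tailMass n α (b + T) - tailMass n α (a - T) := by
    intro l hl
    have hf : ∀ t, HasDerivAt (fun t => tailMass n α (z + l * t))
        (kernel n α (z + l * t) * l) t := fun t =>
      (hasDerivAt_tailMass hn α _).comp t
        (by simpa using ((hasDerivAt_id t).const_mul l).const_add z)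
    have hB : ∀ t, HasDerivAt (fun t => tailMass n α (b + t) - tailMass n α (a - t))
        (kernel n α (b + t) + kernel n α (a - t)) t := fun t => by
      simpa only [sub_neg_eq_add] using ((hasDerivAt_tailMass hn α _).comp_const_add b t).fun_sub
        ((hasDerivAt_tailMass hn α _).comp_const_sub a t)
    refine image_le_of_deriv_right_lt_deriv_boundary (a := 0) (b := T)
      (fun t _ => (hf t).continuousAt.continuousWithinAt) (fun t _ => (hf t).hasDerivWithinAt)
      (by simp [hz]) hB (fun t ht hEq => ?_) (right_mem_Icc.2 hT.le)
    have := h t ht.1 ht.2 _ hEq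
    nlinarith [kernel_pos n α (z + l * t)]
  have hc : Tendsto (fun l => tailMass n α (z + l * T)) (𝓝[<] L) (𝓝 (tailMass n α (z + L * T))) :=
    ((continuous_tailMass hn α).comp (by fun_prop : Continuous fun l : ℝ => z + l * T)).continuousAt
      |>.tendsto.mono_left nhdsWithin_le_nhds
  exact le_of_tendsto hc (eventually_nhdsWithin_of_forall key)

end growth

/-! ### Translation between `g` and `tailMass` -/

section quantile

variable {n : ℕ}

theorem nu_eq_ofReal (hn : 1 ≤ n) (α : ℝ) {s : Set ℝ} (hs : MeasurableSet s) :
    nu n α s = ENNReal.ofReal (normConst n α * ∫ x in s, kernel n α x) := by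
  rw [nu, withDensity_apply _ hs,
    ← ofReal_integral_eq_lintegral_ofReal (integrable_density hn α).integrableOn
      (Eventually.of_forall fun x => (density_pos hn α x).le), ← integral_const_mul]
  rfl

theorem interval_coe (a b : ℝ) : interval a b = Ioo a b := by
  ext x
  simp [interval]

theorem interval_bot (b : ℝ) : interval ⊥ b = Iio b := by
  ext x
  simp [interval, EReal.bot_lt_coe]

theorem nu_interval_coe (hn : 1 ≤ n) (α : ℝ) {a b : ℝ} (hab : a < b) :
    nu n α (interval a b)
      = ENNReal.ofReal (normConst n α * (tailMass n α b - tailMass n α a)) := by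
  rw [interval_coe, nu_eq_ofReal hn α measurableSet_Ioo, ← integral_Ioc_eq_integral_Ioo,
    ← intervalIntegral.integral_of_le hab.le, tailMass_eq_add hn α a b, add_sub_cancel_left]

theorem tailMass_g (hn : 1 ≤ n) (α : ℝ) {a b : ℝ} (hab : a < b) :
    tailMass n α (g n α a b) = tailMass n α b - tailMass n α a := by
  have h := nu_Iio_g hn α (EReal.coe_lt_coe_iff.2 hab)
  have hc := normConst_pos hn α
  have hm := sub_pos.2 (strictMono_tailMass hn α hab)
  rw [nu_interval_coe hn α hab, nu_eq_ofReal hn α measurableSet_Iio,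
    ← integral_Iic_eq_integral_Iio, ← tailMass, ENNReal.ofReal_eq_ofReal_iff
      (mul_nonneg hc.le (tailMass_nonneg n α _)) (by positivity)] at h
  exact mul_left_cancel₀ hc.ne' h

theorem g_bot (hn : 1 ≤ n) (α b : ℝ) : g n α ⊥ b = b :=
  (eq_g hn α (EReal.bot_lt_coe b) (by rw [interval_bot])).symm

theorem tailMass_sub_lt_of_nu_interval_lt (hn : 1 ≤ n) {α a b : ℝ} (hab : a < b)
    (h : nu n α (interval a b) < 1 / 2) :
    tailMass n α b - tailMass n α a < tailMass n α 0 := by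
  have hc := normConst_pos hn α
  rw [nu_interval_coe hn α hab, show (1 / 2 : ENNReal) = ENNReal.ofReal (1 / 2) by
    rw [ENNReal.ofReal_div_of_pos two_pos]; simp, ENNReal.ofReal_lt_ofReal_iff (by norm_num)] at h
  have h2 : normConst n α * (2 * tailMass n α 0) = 1 := by
    rw [← integral_kernel_eq hn α]
    unfold normConst at hc ⊢
    exact inv_mul_cancel₀ (inv_pos.1 hc).ne'
  refine lt_of_mul_lt_mul_left (a := normConst n α) ?_ hc.le
  linarith

theorem mul_le_g_sub_g (hn : 1 ≤ n) {α a b L r : ℝ} (hab : a < b) (hr : 0 < r)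
    (h : ∀ t, 0 ≤ t → t < r → ∀ w, tailMass n α w = tailMass n α (b + t) - tailMass n α (a - t) →
      L * kernel n α w ≤ kernel n α (b + t) + kernel n α (a - t)) :
    L * r ≤ g n α ((a - r : ℝ) : EReal) (b + r) - g n α a b := by
  have h1 := tailMass_add_mul_le hn hr (tailMass_g hn α hab) h
  rw [← tailMass_g hn α (show a - r < b + r by linarith),
    (strictMono_tailMass hn α).le_iff_le] at h1
  linarith

end quantile

end CauchySection

theorem mainTheorem1 (n : ℕ) (hn : 1 ≤ n) (α : ℝ) (hα : 0 ≤ α)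
    (a : EReal) (b : ℝ) (hab : a < (b : EReal)) :
    (∀ r : ℝ, 0 < r →
      CauchySection.g n α (a - (r : EReal)) (b + r) - CauchySection.g n α a b
        ≥ r / (2 : ℝ) ^ (1 / (n : ℝ))) ∧
    (CauchySection.nu n α (CauchySection.interval a b) < 1 / 2 →
      ∃ r₀ : ℝ, 0 < r₀ ∧ ∀ r : ℝ, 0 < r → r < r₀ →
        CauchySection.g n α (a - (r : EReal)) (b + r) - CauchySection.g n α a b ≥ r) := by
  open CauchySection in
  have h2 : (1 : ℝ) ≤ 2 ^ (1 / (n : ℝ)) := Real.one_le_rpow one_le_two (by positivity)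
  induction a with
  | top => simp at hab
  | bot =>
    have hg : ∀ r : ℝ, g n α (⊥ - (r : EReal)) (b + r) - g n α ⊥ b = r := fun r => by
      rw [EReal.bot_sub, g_bot hn, g_bot hn, add_sub_cancel_left]
    simp only [hg]
    exact ⟨fun r hr => div_le_self hr.le h2, fun _ => ⟨1, one_pos, fun r _ _ => le_rfl⟩⟩
  | coe a =>
    have hab' : a < b := EReal.coe_lt_coe_iff.1 hab
    simp only [← EReal.coe_sub]
    refine ⟨fun r hr => ?_, fun hlt => ?_⟩
    · rw [div_eq_inv_mul]
      refine mul_le_g_sub_g hn hab' hr fun t _ _ w hw => ?_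
      -- Reflecting `w` and `b + t` turns the complement of the interval into two left tails with
      -- total `F (-w)`.
      rw [inv_mul_le_iff₀ (by positivity), ← kernel_neg n α w, ← kernel_neg n α (b + t), add_comm]
      refine kernel_le_two_rpow_mul hn α ?_
      rw [tailMass_neg hn, tailMass_neg hn]
      linarith
    · have hc : Continuous fun t => tailMass n α (b + t) - tailMass n α (a - t) :=
        ((continuous_tailMass hn α).comp (by fun_prop)).sub
          ((continuous_tailMass hn α).comp (by fun_prop))
      have h0 := tailMass_sub_lt_of_nu_interval_lt hn hab' hlt
      have hev := hc.continuousAt.eventually_lt (x₀ := 0) (g := fun _ => tailMass n α 0)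
        continuousAt_const (by simpa using h0)
      -- `ε` keeps the mass of `(a - t, b + t)` below one half, so that `w ≤ 0` throughout.
      obtain ⟨ε, hε, hb⟩ := Metric.eventually_nhds_iff.1 hev
      refine ⟨ε, hε, fun r hr hrε => ?_⟩
      refine (one_mul r).ge.trans (mul_le_g_sub_g hn hab' hr fun t ht htr w hw => ?_)
      have ht' := hb (y := t) (by rw [Real.dist_0_eq_abs, abs_of_nonneg ht]; exact htr.trans hrε)
      rw [← hw] at ht'
      rw [one_mul, ← kernel_neg n α (b + t)]
      refine kernel_le_add_of_tailMass_add_eq hn α ((strictMono_tailMass hn α).lt_iff_lt.1 ht').le ?_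
      rw [tailMass_neg hn]
      linarith
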